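/- Let $0<q<1$, $v>-1$ and $a=q^m$ with $m\in\mathbb{Z}$. Put $\mathbb{R}_q=\{\pm q^n : n\in\mathbb{Z}\}$, $[0,a]_q=\{aq^n : n\ge 0\}$, $(z;p)_n=\prod_{i=0}^{n-1}(1-zp^i)$ for $0\le n\le\infty$, and $$\int_0^a f(t)\,d_qt=(1-q)a\sum_{n\ge 0}q^nf(aq^n),\qquad \int_0^\infty f(t)\,d_qt=(1-q)\sum_{n\in\mathbb{Z}}q^nf(q^n).$$ Let $$j_v(z,q^2)=\sum_{n\ge0}(-1)^n\frac{q^{n(n+1)}}{(q^2;q^2)_n(q^{2v+2};q^2)_n}z^{2n},\qquad c_{q,v}=\frac{1}{1-q}\,\frac{(q^{2v+2};q^2)_\infty}{(q^2;q^2)_\infty}.$$ On the real Hilbert space $\mathcal{L}_{q,v,a}$ of functions $u:[0,a]_q\to\mathbb{R}$ with $\int_0^a|u(t)|^2t^{2v+1}\,d_qt<\infty$ and inner product $\int_0^a u(t)w(t)t^{2v+1}\,d_qt$, consider the operator $$T_a^vu(x)=c_{q,v}\int_0^a u(t)\,j_v(xt,q^2)\,t^{2v+1}\,d_qt .$$ Let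 $(\psi_i)_{i\ge0}$ be a system of $q$-prolate spheroidal wave functions: the $\psi_i$ are pairwise orthogonal (nonzero) eigenfunctions of $T_a^v$ in $\mathcal{L}_{q,v,a}$, $T_a^v\psi_i=\lambda_i\psi_i$, that exhaust the eigenfunctions of $T_a^v$ (no eigenfunction is orthogonal to all of them); they are extended from $[0,a]_q$ to $\mathbb{R}_q$ by the same relation $\lambda_i\psi_i(x)=c_{q,v}\int_0^a\psi_i(t)j_v(xt,q^2)t^{2v+1}\,d_qt$, and normalized by $\int_0^\infty\psi_i(t)^2t^{2v+1}\,d_qt=1$. Let $$k(x,y)=c_{q,v}^2\int_0^a j_v(xt,q^2)\,j_v(yt,q^2)\,t^{2v+1}\,d_qt$$ be the kernel of $T_a^v\circ T_a^v$. Then, for all $x,y\in\mathbb{R}_q$, the series below converges unconditionally and $$k(x,y)=\sum_{i=0}^\infty\psi_i(x)\psi_i(y).$$ -/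

import Mathlib

noncomputable section

namespace QProlate

/-- The set `ℝ_q = {± q ^ n : n ∈ ℤ}`. -/
def Rq (q : ℝ) : Set ℝ := {x | ∃ n : ℤ, x = q ^ n ∨ x = -q ^ n}

/-- The set `ℝ_q⁺ = {q ^ n : n ∈ ℤ}`. -/
def RqPos (q : ℝ) : Set ℝ := {x | ∃ n : ℤ, x = q ^ n}

/-- The discrete interval `[0, a]_q = {a q ^ n : n ≥ 0}`; for `a = q ^ m` it is
`{q ^ s : s ∈ ℤ, s ≥ m}`. -/
def interval (q a : ℝ) : Set ℝ := {x | ∃ n : ℕ, x = a * q ^ n}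

/-- The finite `q`-shifted factorial `(z; q)_n`. -/
def poch (z q : ℝ) (n : ℕ) : ℝ := ∏ i ∈ Finset.range n, (1 - z * q ^ i)

/-- The infinite `q`-shifted factorial `(z; q)_∞`. -/
def pochInf (z q : ℝ) : ℝ := ∏' i : ℕ, (1 - z * q ^ i)

/-- Jackson's `q`-integral over `[0, a]`. -/
def qInt (q a : ℝ) (f : ℝ → ℝ) : ℝ := (1 - q) * a * ∑' n : ℕ, q ^ n * f (a * q ^ n)

/-- Jackson's `q`-integral over `[0, ∞)`. -/
def qIntInf (q : ℝ) (f : ℝ → ℝ) : ℝ := (1 - q) * ∑' n : ℤ, q ^ n * f (q ^ n)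

/-- The normalized Hahn-Exton `q`-Bessel function `j_v(z, q)`, at a real argument. -/
def hahnExton (v z q : ℝ) : ℝ :=
  ∑' n : ℕ, (-1) ^ n * (q ^ (n * (n + 1) / 2) / (poch q q n * poch (q ^ (v + 1)) q n)) *
    z ^ (2 * n)

/-- The constant `c_{q,v}`. -/
def cqv (q v : ℝ) : ℝ :=
  1 / (1 - q) * (pochInf (q ^ (2 * v + 2)) (q ^ 2) / pochInf (q ^ 2) (q ^ 2))

/-- Membership in `L_{q,v,a}`: the `q`-integral of `|u|² x^{2v+1}` over `[0, a]` converges.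
Only the values of `u` on `[0, a]_q` matter. -/
def MemL (q v a : ℝ) (u : ℝ → ℝ) : Prop :=
  Summable fun n : ℕ => q ^ n * (|u (a * q ^ n)| ^ 2 * (a * q ^ n) ^ (2 * v + 1))

/-- The inner product of `L_{q,v,a}`. -/
def innerL (q v a : ℝ) (u w : ℝ → ℝ) : ℝ :=
  qInt q a fun t => u t * w t * t ^ (2 * v + 1)

/-- The inner product `⟨f, g⟩` of `L_{q,2,v}`, over the whole half-line. -/
def innerInf (q v : ℝ) (f g : ℝ → ℝ) : ℝ :=
  qIntInf q fun t => f t * g t * t ^ (2 * v + 1)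

/-- The finite `q`-Bessel transform `T_a^v u`, evaluated at an arbitrary real point. -/
def T (q v a : ℝ) (u : ℝ → ℝ) (x : ℝ) : ℝ :=
  cqv q v * qInt q a fun t => u t * hahnExton v (x * t) (q ^ 2) * t ^ (2 * v + 1)

/-- `u` is an eigenfunction of `T_a^v`, acting on `L_{q,v,a}`, with eigenvalue `μ`. -/
structure IsEigenfunction (q v a μ : ℝ) (u : ℝ → ℝ) : Prop where
  mem : MemL q v a u
  nonzero : ∃ x ∈ interval q a, u x ≠ 0
  eigen : ∀ x ∈ interval q a, T q v a u x = μ * u x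

/-- `ψ` is a system of `q`-prolate spheroidal wave functions with eigenvalues `lam`: pairwise
orthogonal eigenfunctions of `T_a^v` on `L_{q,v,a}` that exhaust the eigenfunctions (none is
orthogonal to all of them), continued from `[0, a]_q` to `ℝ_q` by the eigenvalue equation and
normalized in `L_{q,2,v}`. -/
structure IsProlateSystem (q v a : ℝ) (lam : ℕ → ℝ) (ψ : ℕ → ℝ → ℝ) : Prop where
  eigenfunction : ∀ i, IsEigenfunction q v a (lam i) (ψ i)
  orthogonal : ∀ i j, i ≠ j → innerL q v a (ψ i) (ψ j) = 0
  exhaustive : ∀ (μ : ℝ) (u : ℝ → ℝ), IsEigenfunction q v a μ u →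
    ∃ i, innerL q v a u (ψ i) ≠ 0
  continuation : ∀ i, ∀ x ∈ Rq q, T q v a (ψ i) x = lam i * ψ i x
  normalized : ∀ i, innerInf q v (ψ i) (ψ i) = 1

/-- The kernel `k(x, y)` of `T_a^v ∘ T_a^v`. -/
def kernel (q v a x y : ℝ) : ℝ :=
  cqv q v ^ 2 *
    qInt q a fun t => hahnExton v (x * t) (q ^ 2) * hahnExton v (y * t) (q ^ 2) * t ^ (2 * v + 1)

end QProlate

end

open Filter Topology
open scoped InnerProductSpace

noncomputable section

namespace QProlate

/-! Put p = q² and b = q^(v+1). After weighting samples at q^j by b^j, the q-integral inner product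
becomes, up to the factor 1 - q, that of ℓ², and the finite transform becomes the Hankel matrix
(K_{2m+i+j}), where K_j = (1-q) c_{q,v} b^j j_v(q^j, q²). With rows r_j = (K_{j+n})_{n≥0}, the
kernel at points with x² = p^k, y² = p^l is, up to an explicit factor, ⟪r_{k+m}, r_{l+m}⟫. The
theorem is Parseval's identity for these two rows in the eigenvectors e_i of the matrix: the
continuation rule says that ⟪r_{k+m}, e_i⟫ = b^k λ_i ψ_i(x).

Completeness comes from the spectral theorem for compact symmetric operators
(`hasSum_inner_mul_inner_div`). The normalization supplies (1-q)‖e_i‖² = λ_i²: the two-sided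
sequence K is orthonormal to its translates (`hasSum_besselSeq_mul`), so the full transform is an
isometry (`hasSum_inner_hankelRow_sq`). That orthogonality holds because the generating function of
K is (b/t; p)_∞ / (bt; p)_∞, whose product with its reflection under t ↦ 1/t is 1. -/

/-- The coefficients `(-1)^n p^(n(n-1)/2) / (p; p)_n` of Euler's series for `(z; p)_∞`. -/
def eulerCoeff (p : ℝ) (n : ℕ) : ℝ := ∏ i ∈ Finset.range n, (-(p ^ i) / (1 - p * p ^ i))

/-- Euler's series `∑ (-1)^n p^(n(n-1)/2) z^n / (p; p)_n`. -/
def eulerSeries (p z : ℝ) : ℝ := ∑' n : ℕ, eulerCoeff p n * z ^ n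

/-- `1 / (p; p)_j`, extended by zero to negative `j`. -/
def pochInv (p : ℝ) (j : ℤ) : ℝ := if 0 ≤ j then (poch p p j.toNat)⁻¹ else 0

/-! ### Euler's product and series for (z; p)_∞ -/

lemma one_sub_mul_pow_pos {z p : ℝ} (hp0 : 0 < p) (hp1 : p < 1) (hz : z < 1) (n : ℕ) :
    0 < 1 - z * p ^ n := by
  have h1 : p ^ n ≤ 1 := pow_le_one₀ hp0.le hp1.le
  have h2 : 0 < p ^ n := pow_pos hp0 n
  nlinarith

lemma poch_pos {z p : ℝ} (hp0 : 0 < p) (hp1 : p < 1) (hz : z < 1) (n : ℕ) : 0 < poch z p n :=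
  Finset.prod_pos fun i _ => one_sub_mul_pow_pos hp0 hp1 hz i

lemma poch_succ (z p : ℝ) (n : ℕ) : poch z p (n + 1) = poch z p n * (1 - z * p ^ n) :=
  Finset.prod_range_succ _ _

lemma eulerCoeff_succ (p : ℝ) (n : ℕ) :
    eulerCoeff p (n + 1) = eulerCoeff p n * (-(p ^ n) / (1 - p * p ^ n)) :=
  Finset.prod_range_succ _ _

lemma eulerCoeff_succ_mul {p : ℝ} (hp0 : 0 < p) (hp1 : p < 1) (n : ℕ) :
    eulerCoeff p (n + 1) * (1 - p * p ^ n) = -(p ^ n) * eulerCoeff p n := by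
  rw [eulerCoeff_succ, mul_assoc, div_mul_cancel₀ _ (one_sub_mul_pow_pos hp0 hp1 hp1 n).ne',
    mul_comm]

lemma eulerCoeff_zero (p : ℝ) : eulerCoeff p 0 = 1 := by simp [eulerCoeff]

lemma eulerCoeff_mul_pow {p : ℝ} (hp0 : 0 < p) (hp1 : p < 1) (n : ℕ) :
    (-1) ^ n * p ^ (n * (n + 1) / 2) / poch p p n = eulerCoeff p n * p ^ n := by
  induction n with
  | zero => simp [eulerCoeff, poch]
  | succ n ih =>
    have h1 := (poch_pos hp0 hp1 hp1 n).ne'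
    have h2 := (one_sub_mul_pow_pos hp0 hp1 hp1 n).ne'
    have h3 : (n + 1) * (n + 1 + 1) / 2 = n * (n + 1) / 2 + (n + 1) := by
      rw [show (n + 1) * (n + 1 + 1) = n * (n + 1) + (n + 1) * 2 by ring]
      exact Nat.add_mul_div_right _ _ (by norm_num)
    rw [div_eq_iff h1] at ih
    rw [h3, poch_succ, div_eq_iff (mul_ne_zero h1 h2)]
    rw [show (-1 : ℝ) ^ (n + 1) * p ^ (n * (n + 1) / 2 + (n + 1)) =
      -((-1) ^ n * p ^ (n * (n + 1) / 2)) * p ^ (n + 1) by ring, ih]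
    linear_combination (-(p ^ (n + 1) * poch p p n)) * eulerCoeff_succ_mul hp0 hp1 n

lemma summable_norm_eulerCoeff_mul_pow {p : ℝ} (hp0 : 0 < p) (hp1 : p < 1) (z : ℝ) :
    Summable fun n => ‖eulerCoeff p n * z ^ n‖ := by
  have h1 : Tendsto (fun n : ℕ => p ^ n) atTop (𝓝 0) :=
    tendsto_pow_atTop_nhds_zero_of_lt_one hp0.le hp1
  have h2 : Tendsto (fun n : ℕ => |(-(p ^ n) / (1 - p * p ^ n)) * z|) atTop (𝓝 0) := by
    have h3 : Tendsto (fun n : ℕ => 1 - p * p ^ n) atTop (𝓝 1) := by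
      simpa using (h1.const_mul p).const_sub 1
    have h4 := ((h1.neg.div h3 one_ne_zero).mul_const z).abs
    rwa [neg_zero, zero_div, zero_mul, abs_zero] at h4
  refine Summable.norm ?_
  refine summable_of_ratio_norm_eventually_le (r := 1 / 2) (by norm_num) ?_
  filter_upwards [h2.eventually (gt_mem_nhds (show (0 : ℝ) < 1 / 2 by norm_num))] with n hn
  rw [eulerCoeff_succ, show eulerCoeff p n * (-(p ^ n) / (1 - p * p ^ n)) * z ^ (n + 1) =
    ((-(p ^ n) / (1 - p * p ^ n)) * z) * (eulerCoeff p n * z ^ n) by ring, norm_mul]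
  exact mul_le_mul_of_nonneg_right hn.le (norm_nonneg _)

lemma summable_eulerCoeff_mul_pow {p : ℝ} (hp0 : 0 < p) (hp1 : p < 1) (z : ℝ) :
    Summable fun n => eulerCoeff p n * z ^ n :=
  (summable_norm_eulerCoeff_mul_pow hp0 hp1 z).of_norm

lemma eulerSeries_eq_one_sub_mul {p : ℝ} (hp0 : 0 < p) (hp1 : p < 1) (z : ℝ) :
    eulerSeries p z = (1 - z) * eulerSeries p (z * p) := by
  have hs := summable_eulerCoeff_mul_pow hp0 hp1
  have h : eulerSeries p z - eulerSeries p (z * p) = -z * eulerSeries p (z * p) := by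
    unfold eulerSeries
    rw [← (hs z).tsum_sub (hs (z * p)), ← tsum_mul_left,
      ((hs z).sub (hs (z * p))).tsum_eq_zero_add]
    simp only [pow_zero, sub_self, zero_add]
    refine tsum_congr fun n => ?_
    linear_combination z ^ (n + 1) * eulerCoeff_succ_mul hp0 hp1 n
  linarith

lemma eulerSeries_eq_poch_mul {p : ℝ} (hp0 : 0 < p) (hp1 : p < 1) (z : ℝ) (n : ℕ) :
    eulerSeries p z = poch z p n * eulerSeries p (z * p ^ n) := by
  induction n with
  | zero => simp [poch]
  | succ n ih =>
    rw [ih, eulerSeries_eq_one_sub_mul hp0 hp1 (z * p ^ n), poch_succ, pow_succ]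
    ring_nf

lemma tendsto_eulerSeries_mul_pow {p : ℝ} (hp0 : 0 < p) (hp1 : p < 1) (z : ℝ) :
    Tendsto (fun n : ℕ => eulerSeries p (z * p ^ n)) atTop (𝓝 1) := by
  have h1 : Tendsto (fun n : ℕ => z * p ^ n) atTop (𝓝 0) := by
    simpa using (tendsto_pow_atTop_nhds_zero_of_lt_one hp0.le hp1).const_mul z
  have h0 : ∑' k, eulerCoeff p k * (0 : ℝ) ^ k = 1 := by
    rw [tsum_eq_single 0 (fun k hk => by simp [hk])]
    simp [eulerCoeff_zero]
  rw [← h0]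
  refine tendsto_tsum_of_dominated_convergence (summable_norm_eulerCoeff_mul_pow hp0 hp1 z)
    (fun k => (h1.pow k).const_mul _) (Eventually.of_forall fun n k => ?_)
  rw [norm_mul, norm_mul, norm_pow, norm_pow, norm_mul]
  refine mul_le_mul_of_nonneg_left (pow_le_pow_left₀ (by positivity) ?_ k) (norm_nonneg _)
  refine mul_le_of_le_one_right (norm_nonneg _) ?_
  rw [Real.norm_of_nonneg (by positivity)]
  exact pow_le_one₀ hp0.le hp1.le

lemma summable_neg_mul_pow {p : ℝ} (hp0 : 0 < p) (hp1 : p < 1) (z : ℝ) :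
    Summable fun n : ℕ => ‖-(z * p ^ n)‖ :=
  ((summable_geometric_of_lt_one hp0.le hp1).mul_left z).neg.norm

lemma tendsto_poch {p : ℝ} (hp0 : 0 < p) (hp1 : p < 1) (z : ℝ) :
    Tendsto (poch z p) atTop (𝓝 (pochInf z p)) := by
  have h := (multipliable_one_add_of_summable
    (summable_neg_mul_pow hp0 hp1 z)).tendsto_prod_tprod_nat
  simp only [← sub_eq_add_neg] at h
  exact h

/-- Iterating the functional equation f(z) = (1 - z) f(pz) of the series produces the finite
products, and the remaining factor f(z pⁿ) tends to f(0) = 1. No bound on z is needed. -/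
lemma pochInf_eq_eulerSeries {p : ℝ} (hp0 : 0 < p) (hp1 : p < 1) (z : ℝ) :
    pochInf z p = eulerSeries p z := by
  have h := (tendsto_poch hp0 hp1 z).mul (tendsto_eulerSeries_mul_pow hp0 hp1 z)
  simp only [← eulerSeries_eq_poch_mul hp0 hp1 z, mul_one] at h
  exact tendsto_nhds_unique h tendsto_const_nhds

lemma pochInf_eq_poch_mul {p : ℝ} (hp0 : 0 < p) (hp1 : p < 1) (z : ℝ) (n : ℕ) :
    pochInf z p = poch z p n * pochInf (z * p ^ n) p := by
  rw [pochInf_eq_eulerSeries hp0 hp1, pochInf_eq_eulerSeries hp0 hp1,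
    ← eulerSeries_eq_poch_mul hp0 hp1]

lemma pochInf_ne_zero {z p : ℝ} (hp0 : 0 < p) (hp1 : p < 1) (hz : z < 1) : pochInf z p ≠ 0 := by
  have h := tprod_one_add_ne_zero_of_summable (f := fun n : ℕ => -(z * p ^ n))
    (fun n => by rw [← sub_eq_add_neg]; exact (one_sub_mul_pow_pos hp0 hp1 hz n).ne')
    (summable_neg_mul_pow hp0 hp1 z)
  simp only [← sub_eq_add_neg] at h
  exact h

/-- For negative j the product contains the factor 1 - p^(j+1) pⁿ with n = -(j+1), which vanishes.
This is why extension of 1/(p; p)_j by zero is the right convention. -/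
lemma pochInf_zpow_succ {p : ℝ} (hp0 : 0 < p) (hp1 : p < 1) (j : ℤ) :
    pochInf (p ^ (j + 1)) p = pochInf p p * pochInv p j := by
  rcases le_or_gt 0 j with hj | hj
  · obtain ⟨n, rfl⟩ := Int.eq_ofNat_of_zero_le hj
    have h := (poch_pos hp0 hp1 hp1 n).ne'
    rw [pochInv, if_pos hj, Int.toNat_natCast, pochInf_eq_poch_mul hp0 hp1 p n]
    rw [zpow_add_one₀ hp0.ne', zpow_natCast]
    field_simp
  · obtain ⟨n, hn⟩ := Int.eq_ofNat_of_zero_le (show 0 ≤ -(j + 1) by omega)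
    rw [pochInv, if_neg (not_le.2 hj), mul_zero, pochInf_eq_poch_mul hp0 hp1 _ (n + 1), poch_succ,
      ← zpow_natCast p n, ← zpow_add₀ hp0.ne', ← hn]
    simp

lemma exists_pochInv_le {p : ℝ} (hp0 : 0 < p) (hp1 : p < 1) :
    ∃ D, 0 ≤ D ∧ ∀ j, |pochInv p j| ≤ D := by
  have h := ((tendsto_poch hp0 hp1 p).inv₀ (pochInf_ne_zero hp0 hp1 hp1)).abs
  obtain ⟨D, hD⟩ := h.bddAbove_range
  have hD' : ∀ n, |(poch p p n)⁻¹| ≤ D := fun n => hD ⟨n, rfl⟩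
  have h0 := (abs_nonneg _).trans (hD' 0)
  refine ⟨D, h0, fun j => ?_⟩
  unfold pochInv
  split_ifs
  · exact hD' _
  · simpa using h0

/-! ### The Bessel sequence and its orthogonality relation -/

/-- The Fourier coefficients of `(b/t; p)_∞ / (b t; p)_∞`. -/
def besselSeq (p b : ℝ) (j : ℤ) : ℝ :=
  b ^ j * ∑' n : ℕ, eulerCoeff p n * (b ^ 2) ^ n * pochInv p (j + n)

/-- Writing (A; p)_∞ / (A; p)_n = (A pⁿ; p)_∞ and expanding by Euler gives a double series. Summing
it over n first is Euler's series for (p^(j+k+1); p)_∞, that is (p; p)_∞ / (p; p)_{j+k}. -/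
lemma pochInf_div_mul_tsum_eq {p A : ℝ} (hp0 : 0 < p) (hp1 : p < 1) (hA : A < 1) (j : ℤ) :
    pochInf A p / pochInf p p * ∑' n : ℕ, (-1) ^ n * (p ^ (n * (n + 1) / 2) /
      (poch p p n * poch A p n)) * (p ^ j) ^ n =
      ∑' n : ℕ, eulerCoeff p n * A ^ n * pochInv p (j + n) := by
  have hP := pochInf_ne_zero hp0 hp1 hp1
  rw [div_mul_eq_mul_div, div_eq_iff hP, ← tsum_mul_left, ← tsum_mul_right]
  have h1 : ∀ n : ℕ, pochInf A p * ((-1) ^ n * (p ^ (n * (n + 1) / 2) /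
      (poch p p n * poch A p n)) * (p ^ j) ^ n) = ∑' k : ℕ, (eulerCoeff p k * A ^ k) *
        (eulerCoeff p n * (p ^ (j + 1 : ℤ)) ^ n) * (p ^ k) ^ n := by
    intro n
    have h2 : ∀ k : ℕ, (eulerCoeff p k * A ^ k) *
        (eulerCoeff p n * (p ^ (j + 1 : ℤ)) ^ n) * (p ^ k) ^ n =
        (eulerCoeff p n * (p ^ (j + 1 : ℤ)) ^ n) * (eulerCoeff p k * (A * p ^ n) ^ k) := by
      intro k
      rw [mul_pow, ← pow_mul, ← pow_mul p n k, mul_comm n k]; ring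
    simp_rw [h2]
    rw [tsum_mul_left]
    change _ = _ * eulerSeries p (A * p ^ n)
    rw [← pochInf_eq_eulerSeries hp0 hp1, pochInf_eq_poch_mul hp0 hp1 A n, zpow_add_one₀ hp0.ne',
      mul_pow, mul_comm ((p ^ j) ^ n), ← mul_assoc (eulerCoeff p n), ← eulerCoeff_mul_pow hp0 hp1]
    have := (poch_pos hp0 hp1 hp1 n).ne'
    have := (poch_pos hp0 hp1 hA n).ne'
    field_simp
  have h3 : ∀ k : ℕ, eulerCoeff p k * A ^ k * pochInv p (j + k) * pochInf p p = ∑' n : ℕ,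
      (eulerCoeff p k * A ^ k) * (eulerCoeff p n * (p ^ (j + 1 : ℤ)) ^ n) * (p ^ k) ^ n := by
    intro k
    rw [mul_assoc, mul_comm (pochInv _ _), ← pochInf_zpow_succ hp0 hp1,
      pochInf_eq_eulerSeries hp0 hp1, eulerSeries, ← tsum_mul_left]
    refine tsum_congr fun n => ?_
    rw [show j + k + 1 = (j + 1) + k by ring, zpow_add₀ hp0.ne', zpow_natCast, mul_pow]
    ring
  simp_rw [h1, h3]
  symm
  refine (Summable.tsum_comm (f := fun k n : ℕ => (eulerCoeff p k * A ^ k) *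
        (eulerCoeff p n * (p ^ (j + 1 : ℤ)) ^ n) * (p ^ k) ^ n) ?_).symm
  -- The coupling factor p^(kn) is at most 1, so a product of two absolutely convergent Euler series
  -- dominates.
  have hs := (summable_norm_eulerCoeff_mul_pow hp0 hp1 A).mul_of_nonneg
    (summable_norm_eulerCoeff_mul_pow hp0 hp1 (p ^ (j + 1))) (fun _ => norm_nonneg _) (fun _ => norm_nonneg _)
  refine Summable.of_norm_bounded hs fun ⟨k, n⟩ => ?_
  simp only [Function.uncurry]
  rw [norm_mul, norm_mul]
  refine mul_le_of_le_one_right (by positivity) ?_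
  rw [Real.norm_of_nonneg (by positivity)]
  exact pow_le_one₀ (by positivity) (pow_le_one₀ hp0.le hp1.le)

open PowerSeries (rescale coeff_succ_X_mul coeff_rescale coeff_mul X) in
-- The two generating functions satisfy f(X) = (1 - X) f(pX) and g(pX) = (1 - X) g(X). Hence fg is
-- invariant under X ↦ pX, which leaves only its constant term, 1.
lemma sum_eulerCoeff_mul_inv_poch {p : ℝ} (hp0 : 0 < p) (hp1 : p < 1) (s : ℕ) :
    ∑ x ∈ Finset.HasAntidiagonal.antidiagonal s, eulerCoeff p x.1 * (poch p p x.2)⁻¹ = if s = 0 then 1 else 0 := by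
  set f : PowerSeries ℝ := .mk (eulerCoeff p) with hf
  set g : PowerSeries ℝ := .mk fun n => (poch p p n)⁻¹ with hg
  have h1 : f = (1 - X) * rescale p f := by
    ext n
    cases n with
    | zero => rw [sub_mul, one_mul, map_sub, PowerSeries.coeff_zero_X_mul, coeff_rescale]; simp
    | succ n =>
      simp [hf, sub_mul, coeff_succ_X_mul]
      linear_combination eulerCoeff_succ_mul hp0 hp1 n
  have h2 : rescale p g = (1 - X) * g := by
    ext n
    cases n with
    | zero => rw [sub_mul, one_mul, map_sub, PowerSeries.coeff_zero_X_mul, coeff_rescale]; simp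
    | succ n =>
      have h2 := (one_sub_mul_pow_pos hp0 hp1 hp1 n).ne'
      have h3 := (poch_pos hp0 hp1 hp1 n).ne'
      simp [hg, sub_mul, coeff_succ_X_mul, poch_succ]
      generalize hd : 1 - p * p ^ n = d at h2
      rw [show p ^ (n + 1) = 1 - d by rw [← hd]; ring]
      field_simp
  have h3 : rescale p (f * g) = f * g := by
    rw [map_mul, h2]
    conv_rhs => rw [h1]
    ring
  have h4 := congrArg (PowerSeries.coeff s) h3
  rw [coeff_rescale] at h4
  have h5 : PowerSeries.coeff s (f * g) =
    ∑ x ∈ Finset.HasAntidiagonal.antidiagonal s, eulerCoeff p x.1 * (poch p p x.2)⁻¹ := by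
    simp [coeff_mul, hf, hg]
  rw [← h5]
  split_ifs with hs
  · subst hs
    simp [hf, hg, coeff_mul, eulerCoeff_zero, poch]
  · have h6 : p ^ s < 1 := pow_lt_one₀ hp0.le hp1 hs
    have : (1 - p ^ s) * PowerSeries.coeff s (f * g) = 0 := by linarith
    exact (mul_eq_zero.1 this).resolve_left (by linarith)

lemma hasSum_eulerCoeff_mul_pochInv {p : ℝ} (hp0 : 0 < p) (hp1 : p < 1) (s : ℤ) :
    HasSum (fun n : ℕ => eulerCoeff p n * pochInv p (s - n)) (if s = 0 then 1 else 0) := by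
  rcases lt_or_ge s 0 with hs | hs
  · rw [if_neg hs.ne]
    convert! hasSum_zero using 2 with n
    rw [pochInv, if_neg (by omega), mul_zero]
  · obtain ⟨k, rfl⟩ := Int.eq_ofNat_of_zero_le hs
    have h := sum_eulerCoeff_mul_inv_poch hp0 hp1 k
    rw [Finset.Nat.sum_antidiagonal_eq_sum_range_succ
      (fun i j => eulerCoeff p i * (poch p p j)⁻¹)] at h
    simp only [Int.natCast_eq_zero]
    rw [← h, Finset.sum_congr rfl (g := fun n : ℕ => eulerCoeff p n * pochInv p (k - n))]
    · refine hasSum_sum_of_ne_finset_zero fun n hn => ?_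
      have := mt Finset.mem_range.2 hn
      rw [pochInv, if_neg (by omega), mul_zero]
    · intro n hn
      have := Finset.mem_range.1 hn
      rw [pochInv, if_pos (by omega), show ((k : ℤ) - n).toNat = k - n by omega]

lemma summable_zpow_mul_pochInv {p b : ℝ} (hp0 : 0 < p) (hp1 : p < 1) (hb0 : 0 < b) (hb1 : b < 1) :
    Summable fun j : ℤ => ‖b ^ j * pochInv p j‖ := by
  obtain ⟨D, hD0, hD⟩ := exists_pochInv_le hp0 hp1
  refine ((Nat.cast_injective (R := ℤ)).summable_iff fun j hj => ?_).1 ?_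
  · have : ¬ 0 ≤ j := fun h => hj ⟨j.toNat, Int.toNat_of_nonneg h⟩
    simp [pochInv, this]
  · refine Summable.of_nonneg_of_le (fun _ => norm_nonneg _) (fun n => ?_)
      ((summable_geometric_of_lt_one hb0.le hb1).mul_right D)
    simp only [Function.comp]
    rw [norm_mul, zpow_natCast, Real.norm_of_nonneg (by positivity)]
    exact mul_le_mul_of_nonneg_left (hD _) (by positivity)

/-- Controls the sequence only as j → +∞; the bound grows as j → -∞, where square summability comes
from orthogonality instead. -/
lemma abs_besselSeq_le {p b : ℝ} (hp0 : 0 < p) (hp1 : p < 1) (hb0 : 0 < b) :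
    ∃ C, 0 ≤ C ∧ ∀ j, |besselSeq p b j| ≤ C * b ^ j := by
  obtain ⟨D, hD0, hD⟩ := exists_pochInv_le hp0 hp1
  have hs := (summable_norm_eulerCoeff_mul_pow hp0 hp1 (b ^ 2)).mul_right D
  refine ⟨∑' n, ‖eulerCoeff p n * (b ^ 2) ^ n‖ * D, tsum_nonneg fun n => by positivity,
    fun j => ?_⟩
  rw [besselSeq, abs_mul, abs_of_pos (zpow_pos hb0 j), mul_comm]
  refine mul_le_mul_of_nonneg_right ?_ (by positivity)
  rw [← Real.norm_eq_abs]
  refine tsum_of_norm_bounded hs.hasSum fun n => ?_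
  rw [norm_mul]
  exact mul_le_mul_of_nonneg_left (hD _) (norm_nonneg _)

lemma hasSum_besselSeq {p b : ℝ} (hp0 : 0 < p) (hp1 : p < 1) (hb0 : 0 < b) (j : ℤ) :
    HasSum (fun n : ℕ => (eulerCoeff p n * b ^ n) * (b ^ (j + n) * pochInv p (j + n)))
      (besselSeq p b j) := by
  obtain ⟨D, hD0, hD⟩ := exists_pochInv_le hp0 hp1
  have hs : Summable fun n : ℕ => eulerCoeff p n * (b ^ 2) ^ n * pochInv p (j + n) := by
    refine Summable.of_norm_bounded
      ((summable_norm_eulerCoeff_mul_pow hp0 hp1 (b ^ 2)).mul_right D) fun n => ?_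
    rw [norm_mul]
    exact mul_le_mul_of_nonneg_left (hD _) (norm_nonneg _)
  convert! hs.hasSum.mul_left (b ^ j) using 2 with n
  rw [zpow_add₀ hb0.ne', zpow_natCast, ← pow_mul]
  ring

lemma hasSum_convolution {p b : ℝ} (hp0 : 0 < p) (hp1 : p < 1) (hb0 : 0 < b) (s : ℤ) :
    HasSum (fun n : ℕ => (eulerCoeff p n * b ^ n) * (b ^ (s - n) * pochInv p (s - n)))
      (if s = 0 then 1 else 0) := by
  convert! (hasSum_eulerCoeff_mul_pochInv hp0 hp1 s).mul_left (b ^ s) using 1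
  · funext n
    rw [zpow_sub₀ hb0.ne', zpow_natCast]
    field_simp
  · symm
    split_ifs with h
    · simp [h]
    · exact mul_zero _

/-- Each K_j is a sum of α_n β_{j+n}, where α and β are the coefficients of the reciprocal functions
(bz; p)_∞ and 1/(bz; p)_∞. In the resulting triple sum the two α's can be paired crosswise with the
β's, so that both inner sums become convolutions equal to a delta. -/
theorem hasSum_besselSeq_mul {p b : ℝ} (hp0 : 0 < p) (hp1 : p < 1) (hb0 : 0 < b) (hb1 : b < 1)
    (l : ℤ) : HasSum (fun m : ℤ => besselSeq p b m * besselSeq p b (m + l))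
      (if l = 0 then 1 else 0) := by
  set α : ℕ → ℝ := fun n => eulerCoeff p n * b ^ n with hα
  set β : ℤ → ℝ := fun j => b ^ j * pochInv p j with hβ
  have hαs : Summable fun n => ‖α n‖ := summable_norm_eulerCoeff_mul_pow hp0 hp1 b
  have hβs : Summable fun j => ‖β j‖ := summable_zpow_mul_pochInv hp0 hp1 hb0 hb1
  have hβle : ∀ j, ‖β j‖ ≤ ∑' j, ‖β j‖ := fun j =>
    hβs.le_tsum j fun _ _ => norm_nonneg _
  -- For domination: this shift makes the first β independent of n₁, n₂, while the second is merely
  -- bounded.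
  let e₁ : ℤ × (ℕ × ℕ) ≃ ℤ × (ℕ × ℕ) :=
    { toFun := fun x => (x.1 + x.2.1, x.2)
      invFun := fun x => (x.1 - x.2.1, x.2)
      left_inv := fun x => by simp
      right_inv := fun x => by simp }
  -- For evaluation: with s = m + n₁ + n₂ the β indices are s - n₂ and s + l - n₁, which allows the
  -- crosswise pairing.
  let e₂ : ℤ × (ℕ × ℕ) ≃ ℤ × (ℕ × ℕ) :=
    { toFun := fun x => (x.1 + x.2.1 + x.2.2, x.2)
      invFun := fun x => (x.1 - x.2.1 - x.2.2, x.2)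
      left_inv := fun x => Prod.ext (by simp only; ring) rfl
      right_inv := fun x => Prod.ext (by simp only; ring) rfl }
  let F : ℤ × (ℕ × ℕ) → ℝ := fun x =>
    (α x.2.1 * β (x.1 + x.2.1)) * (α x.2.2 * β (x.1 + l + x.2.2))
  have hF : Summable F := by
    have h := (hβs.mul_of_nonneg (hαs.mul_of_nonneg hαs (fun _ => norm_nonneg _)
      (fun _ => norm_nonneg _)) (fun _ => norm_nonneg _) (fun _ => by positivity)).mul_right
      (∑' j, ‖β j‖)
    refine Summable.of_norm_bounded (e₁.summable_iff.2 h) fun x => ?_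
    simp only [F, e₁, Function.comp, Equiv.coe_fn_mk, norm_mul]
    calc _ = ‖β (x.1 + x.2.1)‖ * (‖α x.2.1‖ * ‖α x.2.2‖) * ‖β (x.1 + l + x.2.2)‖ := by ring
      _ ≤ _ := mul_le_mul_of_nonneg_left (hβle _) (by positivity)
  have hL : HasSum (fun m : ℤ => besselSeq p b m * besselSeq p b (m + l)) (∑' x, F x) :=
    hF.hasSum.prod_fiberwise fun m =>
      (hasSum_besselSeq hp0 hp1 hb0 m).mul (hasSum_besselSeq hp0 hp1 hb0 (m + l))
        (hF.prod_factor m)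
  have hR : HasSum (fun s : ℤ => (if s + l = 0 then (1 : ℝ) else 0) * (if s = 0 then 1 else 0))
      (∑' x, F x) := by
    have h2 : HasSum (F ∘ e₂.symm) (∑' x, F x) := e₂.symm.hasSum_iff.2 hF.hasSum
    have hFe : ∀ s x, α x.1 * β (s + l - x.1) * (α x.2 * β (s - x.2)) = (F ∘ e₂.symm) (s, x) := by
      intro s x
      have e1 : s - x.1 - x.2 + x.1 = s - x.2 := by ring
      have e2 : s - x.1 - x.2 + l + x.2 = s + l - x.1 := by ring
      change _ = α x.1 * β (s - x.1 - x.2 + x.1) * (α x.2 * β (s - x.1 - x.2 + l + x.2))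
      rw [e1, e2]
      ring
    refine h2.prod_fiberwise fun s => ?_
    have h3 := (hasSum_convolution hp0 hp1 hb0 (s + l)).mul (hasSum_convolution hp0 hp1 hb0 s)
      (by
        refine (h2.summable.prod_factor s).congr fun x => ?_
        exact (hFe s x).symm)
    exact (funext (hFe s) : _ = fun x => (F ∘ e₂.symm) (s, x)) ▸ h3
  have h4 := hR.unique (hasSum_single (0 : ℤ) fun s hs => by simp [hs])
  rw [h4] at hL
  simpa using hL

theorem hasSum_besselSeq_mul_shift {p b : ℝ} (hp0 : 0 < p) (hp1 : p < 1) (hb0 : 0 < b)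
    (hb1 : b < 1) (i j : ℤ) : HasSum (fun k : ℤ => besselSeq p b (k + i) * besselSeq p b (k + j))
      (if i = j then 1 else 0) := by
  have h := (Equiv.addRight i).hasSum_iff.2 (hasSum_besselSeq_mul hp0 hp1 hb0 hb1 (j - i))
  convert! h using 2 with k
  · simp
  · simp [sub_eq_zero, eq_comm]

/-! ### Completeness of the eigenvectors -/

/-- Parseval's identity for an orthogonal system of eigenvectors of a compact symmetric operator,
provided that no eigenvector is orthogonal to the system. -/
theorem hasSum_inner_mul_inner_div {H : Type*} [NormedAddCommGroup H] [InnerProductSpace ℝ H]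
    [CompleteSpace H] (S : H →L[ℝ] H) (hc : IsCompactOperator S)
    (hs : (S : H →ₗ[ℝ] H).IsSymmetric) (e : ℕ → H) (μ : ℕ → ℝ) (he : ∀ i, e i ≠ 0)
    (heig : ∀ i, S (e i) = μ i • e i) (horth : ∀ i j, i ≠ j → ⟪e i, e j⟫_ℝ = 0)
    (hex : ∀ (ν : ℝ) (u : H), u ≠ 0 → S u = ν • u → ∃ i, ⟪u, e i⟫_ℝ ≠ 0) (x y : H) :
    HasSum (fun i => ⟪x, e i⟫_ℝ * ⟪y, e i⟫_ℝ / ‖e i‖ ^ 2) ⟪x, y⟫_ℝ := by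
  set f : ℕ → H := fun i => ‖e i‖⁻¹ • e i with hf
  have hfo : Orthonormal ℝ f := by
    refine ⟨fun i => ?_, fun i j hij => ?_⟩
    · rw [hf, norm_smul, norm_inv, norm_norm, inv_mul_cancel₀ (norm_ne_zero_iff.2 (he i))]
    · simp [hf, inner_smul_left, inner_smul_right, horth i j hij]
  have hperp : (Submodule.span ℝ (Set.range f))ᗮ = ⊥ := by
    rw [eq_bot_iff, ← ContinuousLinearMap.orthogonalComplement_iSup_eigenspaces_eq_bot hc hs]
    intro u hu
    have hue : ∀ i, ⟪u, e i⟫_ℝ = 0 := by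
      intro i
      have h1 := (Submodule.mem_orthogonal' _ _).1 hu (f i) (Submodule.subset_span ⟨i, rfl⟩)
      rw [hf, inner_smul_right] at h1
      exact (mul_eq_zero.1 h1).resolve_left (inv_ne_zero (norm_ne_zero_iff.2 (he i)))
    rw [← Submodule.iInf_orthogonal, Submodule.mem_iInf]
    intro ν
    set V := Module.End.eigenspace (S : Module.End ℝ H) ν with hV
    have hVc : IsClosed (V : Set H) := by
      have : (V : Set H) = {w | S w = ν • w} := by
        ext w; exact Module.End.mem_eigenspace_iff
      rw [this]
      exact isClosed_eq S.continuous (continuous_const_smul ν)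
    have : CompleteSpace V := hVc.completeSpace_coe
    -- The projection w of u to the ν-eigenspace stays orthogonal to every e i: if e i lies in that
    -- eigenspace, projecting does not change the inner product; otherwise the eigenvalues differ
    -- and symmetry applies. So w is zero by exhaustiveness, kernel eigenvectors (ν = 0) included.
    set w : H := V.starProjection u with hw
    have hwV : w ∈ V := Submodule.starProjection_apply_mem V u
    have hwS : S w = ν • w := Module.End.mem_eigenspace_iff.1 hwV
    have hwe : ∀ i, ⟪w, e i⟫_ℝ = 0 := by
      intro i
      by_cases hi : μ i = ν
      · have heV : e i ∈ V := Module.End.mem_eigenspace_iff.2 (by rw [← hi]; exact heig i)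
        have h2 := Submodule.starProjection_inner_eq_zero (K := V) u (e i) heV
        rw [inner_sub_left, hue i] at h2
        linarith
      · have h2 : ⟪S w, e i⟫_ℝ = ⟪w, S (e i)⟫_ℝ := hs w (e i)
        rw [hwS, heig, inner_smul_left, inner_smul_right] at h2
        have h3 : (μ i - ν) * ⟪w, e i⟫_ℝ = 0 := by
          simp only [conj_trivial] at h2
          linarith
        exact (mul_eq_zero.1 h3).resolve_left (sub_ne_zero.2 hi)
    have hw0 : w = 0 := by
      by_contra h
      obtain ⟨i, hi⟩ := hex ν w h hwS
      exact hi (hwe i)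
    exact (Submodule.starProjection_apply_eq_zero_iff V).1 hw0
  have hb := (HilbertBasis.mkOfOrthogonalEqBot hfo hperp).hasSum_inner_mul_inner x y
  rw [HilbertBasis.coe_mkOfOrthogonalEqBot] at hb
  convert! hb using 2 with i
  rw [hf, inner_smul_left, inner_smul_right, real_inner_comm y, conj_trivial]
  have := norm_ne_zero_iff.2 (he i)
  field_simp

/-! ### Hankel matrices on ℓ² -/

lemma memℓp_two {ι : Type*} {f : ι → ℝ} (hf : Summable fun i => f i ^ 2) :
    Memℓp (E := fun _ => ℝ) f 2 := by
  rw [memℓp_gen_iff (by norm_num)]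
  simpa using hf

lemma lp_inner_eq_tsum {ι : Type*} (f g : lp (fun _ : ι => ℝ) 2) :
    ⟪f, g⟫_ℝ = ∑' i, f i * g i := by
  rw [lp.inner_eq_tsum]
  exact tsum_congr fun i => by simp [mul_comm]

lemma hasSum_lp_inner {ι : Type*} (f g : lp (fun _ : ι => ℝ) 2) :
    HasSum (fun i => f i * g i) ⟪f, g⟫_ℝ := by
  have h := lp.hasSum_inner (𝕜 := ℝ) f g
  convert! h using 2 with i
  simp [mul_comm]

lemma evalCLM_eq {ι : Type*} (i : ι) (f : lp (fun _ : ι => ℝ) 2) :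
    lp.evalCLM (𝕜 := ℝ) (fun _ : ι => ℝ) 2 i f = f i := rfl

/-- The rows `(K_j, K_{j+1}, …)` of the Hankel matrices of a sequence `K`. -/
def hankelRow (K : ℤ → ℝ) (hK : Summable fun j => K j ^ 2) (j : ℤ) : lp (fun _ : ℕ => ℝ) 2 :=
  ⟨fun n => K (j + n), memℓp_two (hK.comp_injective fun a b h => by simpa using h)⟩

lemma hankelRow_apply (K : ℤ → ℝ) (hK : Summable fun j => K j ^ 2) (j : ℤ) (n : ℕ) :
    hankelRow K hK j n = K (j + n) := rfl

/-- The columns (K_{k+n})_{k∈ℤ} are orthonormal in ℓ²(ℤ), so u ↦ ∑ u_n (column n) is an isometry;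
its coordinate at k is the inner product of u with row k. -/
theorem hasSum_inner_hankelRow_sq {K : ℤ → ℝ} (hK : Summable fun j => K j ^ 2)
    (horth : ∀ i j : ℤ, HasSum (fun k : ℤ => K (k + i) * K (k + j)) (if i = j then 1 else 0))
    (u : lp (fun _ : ℕ => ℝ) 2) :
    HasSum (fun k : ℤ => ⟪hankelRow K hK k, u⟫_ℝ ^ 2) (‖u‖ ^ 2) := by
  let G : ℕ → lp (fun _ : ℤ => ℝ) 2 := fun n =>
    ⟨fun k => K (k + n), memℓp_two (hK.comp_injective fun a b h => by simpa using h)⟩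
  have hGo : Orthonormal ℝ G := by
    rw [orthonormal_iff_ite]
    intro i j
    rw [lp_inner_eq_tsum]
    simpa using (horth i j).tsum_eq
  set w := hGo.orthogonalFamily.linearIsometry u with hw
  have hwn : ‖w‖ = ‖u‖ := hGo.orthogonalFamily.linearIsometry.norm_map u
  have hwk : ∀ k, w k = ⟪hankelRow K hK k, u⟫_ℝ := by
    intro k
    have h1 := (hGo.orthogonalFamily.hasSum_linearIsometry u).mapL
      (lp.evalCLM (𝕜 := ℝ) (fun _ : ℤ => ℝ) 2 k)
    refine h1.unique ?_
    convert! hasSum_lp_inner (hankelRow K hK k) u using 2 with n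
    rw [hankelRow_apply]
    rw [evalCLM_eq, LinearIsometry.toSpanSingleton_apply, lp.coeFn_smul, Pi.smul_apply,
      smul_eq_mul, mul_comm]
  have h2 := hasSum_lp_inner w w
  rw [real_inner_self_eq_norm_sq, hwn] at h2
  convert! h2 using 2 with k
  rw [hwk, sq]

lemma norm_hankelRow_le {K : ℤ → ℝ} (hK : Summable fun j => K j ^ 2) {C b : ℝ} (hC : 0 ≤ C)
    (hb0 : 0 < b) (hb1 : b < 1) (hle : ∀ j, |K j| ≤ C * b ^ j) (j : ℤ) :
    ‖hankelRow K hK j‖ ≤ C * √(1 - b ^ 2)⁻¹ * b ^ j := by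
  have hb2 : b ^ 2 < 1 := by nlinarith
  refine abs_le_of_sq_le_sq' ?_ (by positivity) |>.2
  rw [← real_inner_self_eq_norm_sq]
  have hg := (hasSum_geometric_of_lt_one (sq_nonneg b) hb2).mul_left (C ^ 2 * (b ^ j) ^ 2)
  have h := hasSum_le (fun n => ?_) (hasSum_lp_inner (hankelRow K hK j) (hankelRow K hK j)) hg
  · rw [mul_pow, mul_pow, Real.sq_sqrt (inv_nonneg.2 (by linarith))]
    linarith
  · rw [hankelRow_apply, ← sq, ← sq_abs]
    have h3 := pow_le_pow_left₀ (abs_nonneg _) (hle (j + n)) 2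
    rw [zpow_add₀ hb0.ne', zpow_natCast] at h3
    refine h3.trans_eq ?_
    ring

/-- The compact symmetric operator given by a Hankel matrix. -/
theorem exists_hankelOperator {K : ℤ → ℝ} (hK : Summable fun j => K j ^ 2) {C b : ℝ} (hC : 0 ≤ C)
    (hb0 : 0 < b) (hb1 : b < 1) (hle : ∀ j, |K j| ≤ C * b ^ j) (j : ℤ) :
    ∃ S : lp (fun _ : ℕ => ℝ) 2 →L[ℝ] lp (fun _ : ℕ => ℝ) 2, IsCompactOperator S ∧
      (S : lp (fun _ : ℕ => ℝ) 2 →ₗ[ℝ] lp (fun _ : ℕ => ℝ) 2).IsSymmetric ∧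
      ∀ u (n : ℕ), S u n = ⟪hankelRow K hK (j + n), u⟫_ℝ := by
  -- Rank-one pieces, one per column. Their norms decay like bⁿ, so the sum converges in operator
  -- norm and the limit is compact. Rows serve as columns because a Hankel matrix is symmetric.
  let R : ℕ → lp (fun _ : ℕ => ℝ) 2 →L[ℝ] lp (fun _ : ℕ => ℝ) 2 := fun n =>
    (lp.evalCLM (𝕜 := ℝ) (fun _ : ℕ => ℝ) 2 n).smulRight (hankelRow K hK (j + n))
  have hRn : ∀ n, ‖R n‖ ≤ C * √(1 - b ^ 2)⁻¹ * b ^ j * b ^ n := by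
    intro n
    have h1 : ‖lp.evalCLM (𝕜 := ℝ) (fun _ : ℕ => ℝ) 2 n‖ ≤ 1 :=
      ContinuousLinearMap.opNorm_le_bound _ zero_le_one fun x => by
        simpa [evalCLM_eq] using lp.norm_apply_le_norm (by norm_num) x n
    have h2 := norm_hankelRow_le hK hC hb0 hb1 hle (j + n)
    rw [zpow_add₀ hb0.ne', zpow_natCast, ← mul_assoc] at h2
    rw [ContinuousLinearMap.norm_smulRight_apply]
    exact (mul_le_of_le_one_left (norm_nonneg _) h1).trans h2
  have hRs : Summable R := Summable.of_norm_bounded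
    ((summable_geometric_of_lt_one hb0.le hb1).mul_left _) hRn
  have happ : ∀ u : lp (fun _ : ℕ => ℝ) 2, HasSum (fun n : ℕ => u n • hankelRow K hK (j + n)) ((∑' n, R n) u) := fun u =>
    hRs.hasSum.mapL (ContinuousLinearMap.apply ℝ (lp (fun _ : ℕ => ℝ) 2) u)
  have hco : ∀ u (n : ℕ), (∑' n, R n) u n = ⟪hankelRow K hK (j + n), u⟫_ℝ := by
    intro u n
    have h1 := (happ u).mapL (lp.evalCLM (𝕜 := ℝ) (fun _ : ℕ => ℝ) 2 n)
    refine h1.unique ?_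
    convert! hasSum_lp_inner (hankelRow K hK (j + n)) u using 2 with k
    rw [evalCLM_eq, lp.coeFn_smul, Pi.smul_apply, smul_eq_mul, mul_comm, hankelRow_apply,
      hankelRow_apply, add_right_comm]
  refine ⟨∑' n, R n, ?_, fun u w => ?_, hco⟩
  · refine isCompactOperator_of_tendsto hRs.hasSum (Eventually.of_forall fun s => ?_)
    have hR1 : ∀ n, R n ∈ compactOperator (RingHom.id ℝ) (lp (fun _ : ℕ => ℝ) 2)
        (lp (fun _ : ℕ => ℝ) 2) := fun n =>
      (isCompactOperator_of_locallyCompactSpace_dom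
        (lp.evalCLM (𝕜 := ℝ) (fun _ : ℕ => ℝ) 2 n)).clm_comp
        (ContinuousLinearMap.toSpanSingleton ℝ (hankelRow K hK (j + n)))
    exact Submodule.sum_mem (compactOperator (RingHom.id ℝ) _ _) fun n _ => hR1 n
  · have h1 := (happ u).mapL (innerSL ℝ w)
    have h2 := hasSum_lp_inner u ((∑' n, R n) w)
    change ⟪(∑' n, R n) u, w⟫_ℝ = ⟪u, (∑' n, R n) w⟫_ℝ
    rw [real_inner_comm]
    refine h1.unique ?_
    convert! h2 using 2 with n
    rw [hco, innerSL_apply_apply, inner_smul_right, real_inner_comm]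

/-! ### From q-integrals to weighted sequences -/

lemma base_pos_lt_one {q v : ℝ} (hq0 : 0 < q) (hq1 : q < 1) (hv : -1 < v) :
    0 < q ^ (v + 1) ∧ q ^ (v + 1) < 1 :=
  ⟨Real.rpow_pos_of_pos hq0 _, Real.rpow_lt_one hq0.le hq1 (by linarith)⟩

lemma base_sq {q : ℝ} (hq0 : 0 < q) (v : ℝ) : (q ^ (v + 1)) ^ 2 = q ^ (2 * v + 2) := by
  rw [← Real.rpow_mul_natCast hq0.le]
  congr 1
  push_cast
  ring

lemma sq_rpow {q : ℝ} (hq0 : 0 < q) (v : ℝ) : (q ^ 2) ^ (v + 1) = q ^ (2 * v + 2) := by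
  rw [← Real.rpow_natCast_mul hq0.le]
  congr 1
  push_cast
  ring

/-- The mass of the measure t^(2v+1) d_q t at q^j is (1-q) b^(2j), so giving each of two factors a
weight b^j removes the measure up to 1 - q. -/
lemma zpow_mul_rpow {q : ℝ} (hq0 : 0 < q) (v : ℝ) (j : ℤ) :
    q ^ j * (q ^ j) ^ (2 * v + 1) = ((q ^ (v + 1)) ^ j) ^ 2 := by
  rw [← Real.rpow_intCast, ← Real.rpow_mul hq0.le, ← Real.rpow_add hq0, ← Real.rpow_intCast,
    ← Real.rpow_mul hq0.le, ← Real.rpow_mul_natCast hq0.le]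
  congr 1
  push_cast
  ring

lemma zpow_sq_comm (q : ℝ) (k : ℤ) : (q ^ k) ^ 2 = (q ^ 2) ^ k := by
  rw [← zpow_natCast, ← zpow_natCast, ← zpow_mul, ← zpow_mul, mul_comm]

lemma node_sq {q : ℝ} (hq0 : 0 < q) (m : ℤ) (n : ℕ) :
    (q ^ m * q ^ n) ^ 2 = (q ^ 2) ^ (m + n : ℤ) := by
  rw [← zpow_natCast q n, ← zpow_add₀ hq0.ne', zpow_sq_comm]

lemma mul_node_sq {q : ℝ} (hq0 : 0 < q) (m : ℤ) {k : ℤ} {x : ℝ} (hx : x ^ 2 = (q ^ 2) ^ k)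
    (n : ℕ) : (x * (q ^ m * q ^ n)) ^ 2 = (q ^ 2) ^ (k + m + n : ℤ) := by
  rw [mul_pow, hx, node_sq hq0, ← zpow_add₀ (by positivity), add_assoc]

/-- Since j_v is even, only z² matters; this treats both signs in ℝ_q at once. -/
lemma cqv_mul_hahnExton {q v : ℝ} (hq0 : 0 < q) (hq1 : q < 1) (hv : -1 < v) {z : ℝ} {j : ℤ}
    (hz : z ^ 2 = (q ^ 2) ^ j) :
    (1 - q) * cqv q v * (q ^ (v + 1)) ^ j * hahnExton v z (q ^ 2) =
      besselSeq (q ^ 2) (q ^ (v + 1)) j := by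
  have hp0 : 0 < q ^ 2 := by positivity
  have hp1 : q ^ 2 < 1 := by nlinarith
  have hA : q ^ (2 * v + 2) < 1 := Real.rpow_lt_one hq0.le hq1 (by linarith)
  have h := pochInf_div_mul_tsum_eq hp0 hp1 hA j
  have hq : 1 - q ≠ 0 := by linarith
  rw [besselSeq, base_sq hq0, ← h, cqv, hahnExton, sq_rpow hq0]
  simp_rw [pow_mul z, hz]
  field_simp

lemma qInt_mul_rpow {q : ℝ} (hq0 : 0 < q) (v : ℝ) (m : ℤ) (g : ℝ → ℝ) :
    qInt q (q ^ m) (fun t => g t * t ^ (2 * v + 1)) =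
      (1 - q) * ∑' n : ℕ, ((q ^ (v + 1)) ^ (m + n)) ^ 2 * g (q ^ m * q ^ n) := by
  rw [qInt, mul_assoc, ← tsum_mul_left]
  congr 1
  refine tsum_congr fun n => ?_
  rw [← zpow_mul_rpow hq0, zpow_add₀ hq0.ne', zpow_natCast]
  ring

lemma zpow_mul_T {q v : ℝ} (hq0 : 0 < q) (hq1 : q < 1) (hv : -1 < v) (m k : ℤ) {x : ℝ}
    (hx : x ^ 2 = (q ^ 2) ^ k) (u : ℝ → ℝ) :
    (q ^ (v + 1)) ^ k * T q v (q ^ m) u x =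
      ∑' n : ℕ, besselSeq (q ^ 2) (q ^ (v + 1)) (k + m + n) *
        ((q ^ (v + 1)) ^ (m + n) * u (q ^ m * q ^ n)) := by
  have hb := (base_pos_lt_one hq0 hq1 hv).1.ne'
  rw [T, qInt_mul_rpow hq0, ← tsum_mul_left, ← tsum_mul_left, ← tsum_mul_left]
  refine tsum_congr fun n => ?_
  rw [← cqv_mul_hahnExton hq0 hq1 hv (mul_node_sq hq0 m hx n), add_assoc, zpow_add₀ hb k]
  ring

lemma zpow_mul_kernel {q v : ℝ} (hq0 : 0 < q) (hq1 : q < 1) (hv : -1 < v) (m k l : ℤ) {x y : ℝ}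
    (hx : x ^ 2 = (q ^ 2) ^ k) (hy : y ^ 2 = (q ^ 2) ^ l) :
    (1 - q) * (q ^ (v + 1)) ^ k * (q ^ (v + 1)) ^ l * kernel q v (q ^ m) x y =
      ∑' n : ℕ, besselSeq (q ^ 2) (q ^ (v + 1)) (k + m + n) *
        besselSeq (q ^ 2) (q ^ (v + 1)) (l + m + n) := by
  have hb := (base_pos_lt_one hq0 hq1 hv).1.ne'
  rw [kernel, qInt_mul_rpow hq0, ← tsum_mul_left, ← tsum_mul_left, ← tsum_mul_left]
  refine tsum_congr fun n => ?_
  rw [← cqv_mul_hahnExton hq0 hq1 hv (mul_node_sq hq0 m hx n), ← cqv_mul_hahnExton hq0 hq1 hv (mul_node_sq hq0 m hy n),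
    add_assoc, add_assoc, zpow_add₀ hb k, zpow_add₀ hb l]
  ring

lemma innerL_eq_tsum {q : ℝ} (hq0 : 0 < q) (v : ℝ) (m : ℤ) (u w : ℝ → ℝ) :
    innerL q v (q ^ m) u w = (1 - q) * ∑' n : ℕ, ((q ^ (v + 1)) ^ (m + n) * u (q ^ m * q ^ n)) *
      ((q ^ (v + 1)) ^ (m + n) * w (q ^ m * q ^ n)) := by
  rw [innerL, qInt_mul_rpow hq0]
  congr 1
  exact tsum_congr fun n => by ring

lemma innerInf_eq_tsum {q : ℝ} (hq0 : 0 < q) (v : ℝ) (f : ℝ → ℝ) :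
    innerInf q v f f = (1 - q) * ∑' k : ℤ, ((q ^ (v + 1)) ^ k * f (q ^ k)) ^ 2 := by
  rw [innerInf, qIntInf]
  congr 1
  refine tsum_congr fun k => ?_
  rw [mul_pow, ← zpow_mul_rpow hq0]
  ring

lemma memL_iff_summable_sq {q : ℝ} (hq0 : 0 < q) (v : ℝ) (m : ℤ) (u : ℝ → ℝ) :
    MemL q v (q ^ m) u ↔
      Summable fun n : ℕ => ((q ^ (v + 1)) ^ (m + n) * u (q ^ m * q ^ n)) ^ 2 := by
  rw [MemL, ← summable_mul_left_iff (a := q ^ m) (zpow_pos hq0 m).ne']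
  refine summable_congr fun n => ?_
  rw [mul_pow, ← zpow_mul_rpow hq0, zpow_add₀ hq0.ne', zpow_natCast, sq_abs]
  ring

lemma exists_sq_eq_zpow {q x : ℝ} (hx : x ∈ Rq q) : ∃ k : ℤ, x ^ 2 = (q ^ 2) ^ k := by
  obtain ⟨k, rfl | rfl⟩ := hx
  · exact ⟨k, zpow_sq_comm q k⟩
  · exact ⟨k, by rw [neg_sq, zpow_sq_comm]⟩

lemma exists_samples {q : ℝ} (hq0 : 0 < q) (hq1 : q < 1) (v : ℝ) (m : ℤ) (w : ℕ → ℝ) :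
    ∃ u : ℝ → ℝ, ∀ n : ℕ, (q ^ (v + 1)) ^ (m + n) * u (q ^ m * q ^ n) = w n := by
  have hinj : Function.Injective fun n : ℕ => q ^ m * q ^ n := fun i j h =>
    (pow_right_strictAnti₀ hq0 hq1).injective (mul_left_cancel₀ (zpow_pos hq0 m).ne' h)
  refine ⟨Function.extend (fun n : ℕ => q ^ m * q ^ n)
    (fun n => w n / (q ^ (v + 1)) ^ (m + n)) 0, fun n => ?_⟩
  have h := hinj.extend_apply (fun n => w n / (q ^ (v + 1)) ^ (m + n)) 0 n
  rw [h, mul_div_cancel₀]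
  exact (zpow_pos (Real.rpow_pos_of_pos hq0 _) _).ne'

end QProlate

end

open QProlate

/-! ### Assembly of the expansion -/

theorem corollary1 (q v a : ℝ) (hq0 : 0 < q) (hq1 : q < 1) (hv : -1 < v)
    (ha : a ∈ QProlate.RqPos q) (lam : ℕ → ℝ) (ψ : ℕ → ℝ → ℝ)
    (hψ : QProlate.IsProlateSystem q v a lam ψ) :
    ∀ x ∈ QProlate.Rq q, ∀ y ∈ QProlate.Rq q,
      HasSum (fun i : ℕ => ψ i x * ψ i y) (QProlate.kernel q v a x y) := by
  obtain ⟨m, rfl⟩ := ha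
  have hp0 : 0 < q ^ 2 := by positivity
  have hp1 : q ^ 2 < 1 := by nlinarith
  obtain ⟨hb0, hb1⟩ := base_pos_lt_one hq0 hq1 hv
  have hq : 0 < 1 - q := by linarith
  set b := q ^ (v + 1) with hb
  set K := besselSeq (q ^ 2) b
  have horth : ∀ i j : ℤ, HasSum (fun k : ℤ => K (k + i) * K (k + j)) (if i = j then 1 else 0) :=
    hasSum_besselSeq_mul_shift hp0 hp1 hb0 hb1
  have hK : Summable fun j => K j ^ 2 := by
    simpa only [add_zero, ← sq] using (horth 0 0).summable
  obtain ⟨C, hC0, hC⟩ := abs_besselSeq_le hp0 hp1 hb0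
  -- The offset is 2m: one m from the sample points t = q^(m+n), one from evaluating at x in the
  -- same interval.
  obtain ⟨S, hSc, hSs, hS⟩ := exists_hankelOperator hK hC0 hb0 hb1 hC (m + m)
  set r := hankelRow K hK with hr
  have hT : ∀ (k : ℤ) (x : ℝ), x ^ 2 = (q ^ 2) ^ k → ∀ (u : ℝ → ℝ) (w : lp (fun _ : ℕ => ℝ) 2),
      (∀ n : ℕ, b ^ (m + n) * u (q ^ m * q ^ n) = w n) →
      b ^ k * T q v (q ^ m) u x = ⟪r (k + m), w⟫_ℝ := by
    intro k x hx u w hw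
    rw [zpow_mul_T hq0 hq1 hv m k hx, lp_inner_eq_tsum]
    exact tsum_congr fun n => by rw [← hw n]; rfl
  have hpt := node_sq hq0 m
  have hptR : ∀ n : ℕ, q ^ m * q ^ n ∈ Rq q := fun n =>
    ⟨m + n, Or.inl (by rw [zpow_add₀ hq0.ne', zpow_natCast])⟩
  let e : ℕ → lp (fun _ : ℕ => ℝ) 2 := fun i =>
    ⟨fun n => b ^ (m + n : ℤ) * ψ i (q ^ m * q ^ n),
      memℓp_two ((memL_iff_summable_sq hq0 v m _).1 (hψ.eigenfunction i).mem)⟩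
  have hew : ∀ i (n : ℕ), b ^ (m + n : ℤ) * ψ i (q ^ m * q ^ n) = e i n := fun _ _ => rfl
  have hinner : ∀ u (w : lp (fun _ : ℕ => ℝ) 2),
      (∀ n : ℕ, b ^ (m + n : ℤ) * u (q ^ m * q ^ n) = w n) → ∀ i,
      innerL q v (q ^ m) u (ψ i) = (1 - q) * ⟪w, e i⟫_ℝ := by
    intro u w hw i
    rw [innerL_eq_tsum hq0, lp_inner_eq_tsum]
    simp only [← hb, hw, hew]
  have he0 : ∀ i, e i ≠ 0 := by
    intro i h
    obtain ⟨x, ⟨n, rfl⟩, hx⟩ := (hψ.eigenfunction i).nonzero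
    have h1 := hew i n
    rw [h] at h1
    exact mul_ne_zero (zpow_pos hb0 _).ne' hx h1
  have hrow : ∀ i (k : ℤ) (x : ℝ), x ∈ Rq q → x ^ 2 = (q ^ 2) ^ k →
      ⟪r (k + m), e i⟫_ℝ = b ^ k * (lam i * ψ i x) := by
    intro i k x hx hk
    rw [← hT k x hk (ψ i) (e i) (hew i), hψ.continuation i x hx]
  have heig : ∀ i, S (e i) = lam i • e i := by
    intro i
    ext n
    rw [hS, show m + m + (n : ℤ) = m + n + m by ring, hrow i _ _ (hptR n) (hpt n),
      lp.coeFn_smul, Pi.smul_apply, ← hew, smul_eq_mul]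
    ring
  have heo : ∀ i j, i ≠ j → ⟪e i, e j⟫_ℝ = 0 := by
    intro i j hij
    have h := hinner (ψ i) (e i) (hew i) j
    rw [hψ.orthogonal i j hij] at h
    exact (mul_eq_zero.1 h.symm).resolve_left hq.ne'
  -- Exhaustiveness concerns functions on ℝ, so an ℓ² eigenvector is first realized as the weighted
  -- samples of such a function.
  have hex : ∀ (ν : ℝ) (w : lp (fun _ : ℕ => ℝ) 2), w ≠ 0 → S w = ν • w →
      ∃ i, ⟪w, e i⟫_ℝ ≠ 0 := by
    intro ν w hw hSw
    obtain ⟨u, hu⟩ := exists_samples hq0 hq1 v m w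
    have hIs : IsEigenfunction q v (q ^ m) ν u := by
      refine ⟨(memL_iff_summable_sq hq0 v m u).2 ?_, ?_, ?_⟩
      · simp only [hu, sq]
        exact (hasSum_lp_inner w w).summable
      · by_contra! h
        refine hw (lp.ext (funext fun n => ?_))
        rw [← hu n, h _ ⟨n, rfl⟩, mul_zero]
        rfl
      · rintro x ⟨n, rfl⟩
        have h := hT _ _ (hpt n) u w hu
        rw [show (m + n + m : ℤ) = m + m + n by ring, ← hS, hSw, lp.coeFn_smul, Pi.smul_apply,
          ← hu n, smul_eq_mul] at h
        refine mul_left_cancel₀ (zpow_pos hb0 (m + n : ℤ)).ne' ?_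
        rw [h]
        ring
    obtain ⟨i, hi⟩ := hψ.exhaustive ν u hIs
    rw [hinner u w hu i] at hi
    exact ⟨i, right_ne_zero_of_mul hi⟩
  -- The rows indexed by all of ℤ applied to e i give the weighted samples of λ_i ψ_i on the whole
  -- half-line. The isometry therefore turns the normalization of ψ_i there into the norm of e i on
  -- [0, a]_q.
  have hnorm : ∀ i, (1 - q) * ‖e i‖ ^ 2 = lam i ^ 2 := by
    intro i
    have h1 := (Equiv.addRight m).hasSum_iff.2 (hasSum_inner_hankelRow_sq hK horth (e i))
    have h2 := hψ.normalized i
    rw [innerInf_eq_tsum hq0] at h2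
    have h3 : ‖e i‖ ^ 2 = lam i ^ 2 * ∑' k : ℤ, (b ^ k * ψ i (q ^ k)) ^ 2 := by
      rw [← h1.tsum_eq, ← tsum_mul_left]
      refine tsum_congr fun k => ?_
      change ⟪r (k + m), e i⟫_ℝ ^ 2 = _
      rw [hrow i k (q ^ k) ⟨k, Or.inl rfl⟩ (zpow_sq_comm q k)]
      ring
    rw [h3, mul_left_comm, h2, mul_one]
  intro x hx y hy
  obtain ⟨k, hk⟩ := exists_sq_eq_zpow hx
  obtain ⟨l, hl⟩ := exists_sq_eq_zpow hy
  have hmain := hasSum_inner_mul_inner_div S hSc hSs e lam he0 heig heo hex (r (k + m)) (r (l + m))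
  have hker : ⟪r (k + m), r (l + m)⟫_ℝ = (1 - q) * b ^ k * b ^ l * kernel q v (q ^ m) x y := by
    rw [zpow_mul_kernel hq0 hq1 hv m k l hk hl, lp_inner_eq_tsum]
    rfl
  have hc : (1 - q) * b ^ k * b ^ l ≠ 0 := by positivity
  rw [hker] at hmain
  rw [← hasSum_mul_left_iff hc]
  convert! hmain using 2 with i
  have hn : 0 < ‖e i‖ := norm_pos_iff.2 (he0 i)
  rw [hrow i k x hx hk, hrow i l y hy hl, eq_div_iff (by positivity)]
  -- Each Parseval term carries λ_i² / ‖e i‖², which is 1 - q; no division by λ_i occurs.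
  linear_combination (b ^ k * b ^ l * (ψ i x * ψ i y)) * hnorm i
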